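/- Consider a synchronous system of $n$ processes with distinct identifiers $1,\dots,n$, connected by a complete communication graph. An execution proceeds in rounds; in each round every process may send a message to each process and then receives the messages sent to it in that round. The channels are authenticated (the receiver of a message knows its true sender), and no signatures are available. Correct processes follow a given deterministic algorithm, which may depend on $n$, $f$, the semilattice and the set $E$ below; Byzantine processes may send arbitrary messages, possibly different ones to different processes. Let $(V,\oplus)$ be a join semilattice, ordered by $u\le v\iff v=u\oplus v$, and let $E\subseteq V$ be the set of allowed proposal values. Each correct process $p_i$ starts with a proposal $pro_i\in E$. An algorithm *solves Byzantine lattice agreement against $f$ Byzantine processes* if, in every execution in which at most $f$ processes are Byzantine, the following hold. - Liveness: each correct process $p_i$ eventually outputs a decision $dec_i\in V$. - Stability: each correct process outputs only one decision value. - Comparability: for all correct $p_i,p_j$, $dec_i\le dec_j$ or $dec_j\le dec_i$. - Inclusivity: $pro_i\le dec_i$ for every correct $p_i$. - Non-triviality: there is a set $B\subseteq E$ with $|B|\le f$ such that $dec_i\le\bigoplus(X\cup B)$ for every correct $p_i$, where $X$ is the set of proposals of the correct processes. It *terminates in $r$ rounds* if in every such execution every correct process decides within the first $r$ rounds and sends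 no message afterwards. **Theorem.** There is a function $R:\mathbb N\to\mathbb N$ with $R(f)=O(\log f)$ as $f\to\infty$ such that for all $n,f\in\mathbb N$ with $n\ge 4f+1$, every join semilattice $(V,\oplus)$ and every $E\subseteq V$, there is an algorithm for $n$ processes that solves Byzantine lattice agreement against $f$ Byzantine processes in the model above and terminates in $R(f)$ rounds. -/

import Mathlib

universe u

/-- A deterministic synchronous message-passing algorithm for `n` processes with identifiers in
`Fin n`, with inputs and decisions in `V`. A round consists of a send phase followed by a receive
phase. There is no signature facility: messages are plain data, and any process may send any of
them. -/
structure SyncAlgorithm (n : ℕ) (V : Type u) where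
  /-- Local states. -/
  State : Type u
  /-- Messages. -/
  Msg : Type u
  /-- The initial state of a process, from its identifier and its proposal. -/
  init : Fin n → V → State
  /-- The message, if any, sent to each process in the send phase of a round. -/
  send : State → Fin n → Option Msg
  /-- The state after the receive phase of a round, from the state before it and the messages
  received in it. Channels are authenticated: the received messages are indexed by their true
  sender. -/
  receive : State → (Fin n → Option Msg) → State
  /-- The decision output in a state, if any. -/
  decision : State → Option V

namespace SyncAlgorithm

variable {n : ℕ} {V : Type u}

/-- `A.run F pro byz t p` is the state of the correct process `p` after `t` rounds, when the set of
Byzantine processes is `F`, the proposals are `pro`, and `byz t q p` is the message, if any, that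
the Byzantine process `q` sends to `p` in the round with index `t` (the first one has index `0`).
The values of `pro`, and of the run itself, at Byzantine processes are never used by a correct
process. -/
def run (A : SyncAlgorithm n V) (F : Finset (Fin n)) (pro : Fin n → V)
    (byz : ℕ → Fin n → Fin n → Option A.Msg) : ℕ → Fin n → A.State
  | 0, p => A.init p (pro p)
  | t + 1, p => A.receive (A.run F pro byz t p)
      (fun q => if q ∈ F then byz t q p else A.send (A.run F pro byz t q) p)

end SyncAlgorithm

open Classical in
/-- The requirements of Byzantine lattice agreement on the decisions `dec` of the correct processes
(those outside `F`), for proposals `pro`, allowed proposal values `E` and resilience `f`. -/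
structure IsLatticeAgreement {n : ℕ} {V : Type u} [SemilatticeSup V] (E : Set V) (f : ℕ)
    (F : Finset (Fin n)) (pro dec : Fin n → V) : Prop where
  comparability : ∀ p, p ∉ F → ∀ q, q ∉ F → dec p ≤ dec q ∨ dec q ≤ dec p
  inclusivity : ∀ p, p ∉ F → pro p ≤ dec p
  nonTriviality : ∃ B : Finset V, (B : Set V) ⊆ E ∧ B.card ≤ f ∧
    ∀ p, p ∉ F → ∃ h : (Fᶜ.image pro ∪ B).Nonempty, dec p ≤ (Fᶜ.image pro ∪ B).sup' h id

/-- `A` solves Byzantine lattice agreement on the join semilattice `V` with allowed proposal values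
`E`, against up to `f` Byzantine processes, and terminates within `R` rounds: in every run, every
correct process decides within the first `R` rounds (liveness), never outputs two different
decisions (stability), sends nothing after the first `R` rounds, and the decisions of the correct
processes satisfy comparability, inclusivity and non-triviality. -/
def SyncAlgorithm.SolvesByzantineLA {n : ℕ} {V : Type u} [SemilatticeSup V]
    (A : SyncAlgorithm n V) (E : Set V) (f R : ℕ) : Prop :=
  ∀ F : Finset (Fin n), F.card ≤ f →
  ∀ pro : Fin n → V, (∀ p, p ∉ F → pro p ∈ E) →
  ∀ byz : ℕ → Fin n → Fin n → Option A.Msg,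
  ∃ dec : Fin n → V,
    (∀ p, p ∉ F → ∃ t ≤ R, A.decision (A.run F pro byz t p) = some (dec p)) ∧
    (∀ p, p ∉ F → ∀ t v, A.decision (A.run F pro byz t p) = some v → v = dec p) ∧
    (∀ p, p ∉ F → ∀ t ≥ R, ∀ q, A.send (A.run F pro byz t p) q = none) ∧
    IsLatticeAgreement E f F pro dec

/-! Proposals travel as items (originator, value). In the first stage an item is accepted when `n -
f` processes echo it, and a correct process echoes at most one item per originator. Two such quorums
share a correct process, so all accepted items lie in a set `U` with one item per originator; its
Byzantine items give the set `B` of non-triviality.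

The later stages are a binary search on the number of items known. A process counts the items of its
group echoed by at least `n - 2 * f` processes (level 2). Above a threshold it adopts them and joins
the upper half of the group; otherwise it keeps its value and joins the lower half. Echo counts at
two processes differ by at most `f`, so level 1 anywhere lies in level 2 everywhere, and level 2 in
level 3. The lower half is confined to level 1 and the upper half to level 3, so lower values remain
below upper ones. Level 3 still needs `n - 3 * f > f` echoes, hence a correct one: this is where `n
≥ 4 * f + 1` enters.

The second stage brings everyone to at least `n - f` items, leaving `f + 1` possible sizes. About
`log f` halvings (`Invariant.next`) then make values within a group equal
(`Invariant.value_subset_or`). -/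

namespace ByzantineLA

/-! ### Echo counts and quorums -/

section Levels

variable {n : ℕ} {X : Type*}

/-- The set of items about group `g` in the message received from `q`. -/
def heard (m : Fin n → Option (ℕ → Set X)) (q : Fin n) (g : ℕ) : Set X :=
  (m q).elim ∅ (fun c => c g)

/-- The items about group `g` that were received from at least `n - j * f` processes. -/
def level (f j : ℕ) (m : Fin n → Option (ℕ → Set X)) (g : ℕ) : Set X :=
  {x | n ≤ {q | x ∈ heard m q g}.ncard + j * f}

variable {f g : ℕ} {F : Finset (Fin n)} {m m' : Fin n → Option (ℕ → Set X)}

/-- Only the at most `f` Byzantine senders can tell two receivers different things. -/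
lemma level_subset_level_succ (hF : F.card ≤ f)
    (h : ∀ q, q ∉ F → heard m q g = heard m' q g) (j : ℕ) :
    level f j m g ⊆ level f (j + 1) m' g := by
  intro x hx
  have h1 : {q | x ∈ heard m q g} ⊆ {q | x ∈ heard m' q g} ∪ (F : Set (Fin n)) := by
    intro q hq
    by_cases hqF : q ∈ F
    · exact Or.inr hqF
    · left
      simpa only [Set.mem_ofPred_eq, ← h q hqF] using hq
  have h2 := (Set.ncard_le_ncard h1 (Set.toFinite _)).trans (Set.ncard_union_le _ _)
  rw [Set.ncard_coe_finset] at h2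
  simp only [level, Set.mem_ofPred_eq] at hx ⊢
  linarith [add_mul j 1 f]

lemma mem_level_one (hF : F.card ≤ f) {x : X} (h : ∀ q, q ∉ F → x ∈ heard m q g) :
    x ∈ level f 1 m g := by
  have h1 : ((Fᶜ : Finset (Fin n)) : Set (Fin n)) ⊆ {q | x ∈ heard m q g} := by
    intro q hq
    exact h q (by simpa using hq)
  have h2 := Set.ncard_le_ncard h1 (Set.toFinite _)
  rw [Set.ncard_coe_finset, Finset.card_compl, Fintype.card_fin] at h2
  simp only [level, Set.mem_ofPred_eq]
  omega

lemma exists_heard_of_mem_level_three (hF : F.card ≤ f) (hn : 4 * f + 1 ≤ n) {x : X}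
    (hx : x ∈ level f 3 m g) : ∃ q, q ∉ F ∧ x ∈ heard m q g := by
  by_contra! hcon
  have h1 : {q | x ∈ heard m q g} ⊆ (F : Set (Fin n)) := by
    intro q hq
    by_contra hqF
    exact hcon q hqF hq
  have h2 := Set.ncard_le_ncard h1 (Set.toFinite _)
  rw [Set.ncard_coe_finset] at h2
  simp only [level, Set.mem_ofPred_eq] at hx
  omega

/-- Two quorums of `n - f` processes share a correct process. -/
lemma exists_heard_heard_of_mem_level_one (hF : F.card ≤ f) (hn : 4 * f + 1 ≤ n) {x y : X}
    (hx : x ∈ level f 1 m g) (hy : y ∈ level f 1 m' g) :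
    ∃ q, q ∉ F ∧ x ∈ heard m q g ∧ y ∈ heard m' q g := by
  by_contra! hcon
  have h1 : {q | x ∈ heard m q g} ∩ {q | y ∈ heard m' q g} ⊆ (F : Set (Fin n)) := by
    intro q hq
    by_contra hqF
    exact hcon q hqF hq.1 hq.2
  have h2 := Set.ncard_le_ncard h1 (Set.toFinite _)
  have h3 := Set.ncard_union_add_ncard_inter {q | x ∈ heard m q g} {q | y ∈ heard m' q g}
  have h4 := Set.ncard_le_card ({q | x ∈ heard m q g} ∪ {q | y ∈ heard m' q g})
  rw [Set.ncard_coe_finset] at h2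
  rw [Nat.card_eq_fintype_card, Fintype.card_fin] at h4
  simp only [level, Set.mem_ofPred_eq] at hx hy
  omega

end Levels

/-! ### The classification algorithm -/

section Algorithm

variable {n : ℕ} {V : Type u}

/-- The local state of a process. An item `(s, v)` says that `s` proposed `v`. -/
structure LocalState (n : ℕ) (V : Type u) : Type u where
  /-- The number of completed stages. -/
  stage : ℕ
  /-- Whether the first round of the current stage is over. -/
  echoing : Bool
  /-- The group of the process. -/
  group : ℕ
  /-- The current set of items. -/
  value : Set (Fin n × V)
  /-- The items that a member of a group may hold. -/
  valid : ℕ → Set (Fin n × V)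
  /-- The items about each group to be sent in the second round of the current stage. -/
  echo : ℕ → Set (Fin n × V)

/-- The items that a process in state `s` echoes after the first round of a stage. In the first
stage, an item is echoed only if it is the only one sent by its originator. -/
def echoSet (s : LocalState n V) (m : Fin n → Option (ℕ → Set (Fin n × V))) (g : ℕ) :
    Set (Fin n × V) :=
  {x | x ∈ s.valid g ∧ (∃ q, x ∈ heard m q g) ∧ (s.stage = 0 → heard m x.1 g = {x})}

/-- The criterion to move to the upper half of a group. -/
def MovesUp (f K : ℕ) (s : LocalState n V) (m : Fin n → Option (ℕ → Set (Fin n × V))) : Prop :=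
  1 ≤ s.stage ∧
    -- Midpoint of the size interval of the group in `Invariant`; `2 ^ K` is moved to the right to
    -- avoid truncated subtraction.
    n - f - 1 + (2 * s.group + 1) * 2 ^ (K + 1 - s.stage) < (level f 2 m s.group).ncard + 2 ^ K

open Classical in
/-- The state at the end of a stage, from the state at its beginning and the messages received in
its second round. -/
noncomputable def advance (f K : ℕ) (s : LocalState n V)
    (m : Fin n → Option (ℕ → Set (Fin n × V))) : LocalState n V where
  stage := s.stage + 1
  echoing := false
  group := if MovesUp f K s m then 2 * s.group + 1 else 2 * s.group
  value := if MovesUp f K s m then level f 2 m s.group else s.value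
  valid g := if g % 2 = 1 then level f 3 m (g / 2) else level f 1 m (g / 2)
  echo _ := ∅

/-- The initial state. -/
def start (E : Set V) (p : Fin n) (v : V) : LocalState n V :=
  ⟨0, false, 0, {(p, v)}, fun _ => {x | x.2 ∈ E}, fun _ => ∅⟩

/-- The message sent to everyone in a round. -/
def outgoing (K : ℕ) (s : LocalState n V) : Option (ℕ → Set (Fin n × V)) :=
  if K + 2 ≤ s.stage then none
  else if s.echoing then some s.echo
  else some (fun g => {x | g = s.group ∧ x ∈ s.value})

/-- The state after a round, from the state before it and the messages received. -/
noncomputable def update (f K : ℕ) (s : LocalState n V)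
    (m : Fin n → Option (ℕ → Set (Fin n × V))) : LocalState n V :=
  if K + 2 ≤ s.stage then s
  else if s.echoing then advance f K s m
  else { s with echoing := true, echo := echoSet s m }

open Classical in
/-- The decision in a state: the join of the known proposals, once all stages are over. -/
noncomputable def output [SemilatticeSup V] (K : ℕ) (s : LocalState n V) : Option V :=
  if h : K + 2 ≤ s.stage ∧ ∃ d, IsLUB (Prod.snd '' s.value) d then some h.2.choose else none

/-- The lattice agreement algorithm: processes are repeatedly classified by the number of items
they know of, in `K + 2` stages of two rounds. -/
noncomputable def algorithm (n : ℕ) [SemilatticeSup V] (E : Set V) (f K : ℕ) :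
    SyncAlgorithm n V where
  State := LocalState n V
  Msg := ℕ → Set (Fin n × V)
  init := start E
  send s _ := outgoing K s
  receive := update f K
  decision := output K

/-- The states of the processes after `t` rounds of the algorithm. -/
noncomputable def states (E : Set V) (f K : ℕ) (F : Finset (Fin n)) (pro : Fin n → V)
    (byz : ℕ → Fin n → Fin n → Option (ℕ → Set (Fin n × V))) : ℕ → Fin n → LocalState n V
  | 0, p => start E p (pro p)
  | t + 1, p => update f K (states E f K F pro byz t p)
      (fun q => if q ∈ F then byz t q p else outgoing K (states E f K F pro byz t q))

lemma run_algorithm [SemilatticeSup V] (E : Set V) (f K : ℕ) (F : Finset (Fin n))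
    (pro : Fin n → V) (byz : ℕ → Fin n → Fin n → Option (ℕ → Set (Fin n × V))) (t : ℕ) :
    (algorithm n E f K).run F pro byz t = states E f K F pro byz t := by
  induction t with
  | zero => rfl
  | succ t ih =>
    funext p
    rw [states, ← ih]
    rfl

end Algorithm

/-! ### Invariant and correctness -/

section Correctness

variable {n f K : ℕ} {V : Type u} {E : Set V} {F : Finset (Fin n)}
  {pro : Fin n → V} {byz : ℕ → Fin n → Fin n → Option (ℕ → Set (Fin n × V))}

/-- The messages exchanged in the two rounds of a stage that leads from the states `σ` to the
states `τ`. -/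
structure IsStage (f K : ℕ) (F : Finset (Fin n)) (σ τ : Fin n → LocalState n V)
    (m m' : Fin n → Fin n → Option (ℕ → Set (Fin n × V))) : Prop where
  heard_fst : ∀ p q, q ∉ F → ∀ g,
    heard (m p) q g = {x | g = (σ q).group ∧ x ∈ (σ q).value}
  heard_snd : ∀ p q, q ∉ F → ∀ g, heard (m' p) q g = echoSet (σ q) (m q) g
  eq_advance : ∀ p, τ p = advance f K (σ p) (m' p)

lemma exists_isStage {i : ℕ} (hi : i < K + 2)
    (hσ : ∀ p, (states E f K F pro byz (2 * i) p).stage = i ∧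
      (states E f K F pro byz (2 * i) p).echoing = false) :
    ∃ m m', IsStage f K F (states E f K F pro byz (2 * i))
      (states E f K F pro byz (2 * (i + 1))) m m' := by
  have h1 : ∀ p, states E f K F pro byz (2 * i + 1) p = update f K _ _ := fun p => states.eq_2 ..
  have h2 : ∀ p, states E f K F pro byz (2 * (i + 1)) p = update f K _ _ := fun p => states.eq_2 ..
  generalize states E f K F pro byz (2 * (i + 1)) = υ at h2 ⊢
  generalize states E f K F pro byz (2 * i + 1) = τ at h1 h2
  generalize states E f K F pro byz (2 * i) = σ at hσ h1 ⊢
  have hlt : ∀ p, ¬ K + 2 ≤ (σ p).stage := fun p => by rw [(hσ p).1]; omega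
  have hτ : ∀ p, τ p = { σ p with
      echoing := true
      echo := echoSet (σ p) fun q => if q ∈ F then byz (2 * i) q p else outgoing K (σ q) } := by
    intro p
    rw [h1 p, update, if_neg (hlt p), if_neg (by simp [(hσ p).2])]
  refine ⟨fun p q => if q ∈ F then byz (2 * i) q p else outgoing K (σ q),
    fun p q => if q ∈ F then byz (2 * i + 1) q p else outgoing K (τ q), ?_, ?_, ?_⟩
  · intro p q hq g
    simp only [heard, if_neg hq, outgoing, if_neg (hlt q), (hσ q).2, Bool.false_eq_true,
      if_false, Option.elim_some]
  · intro p q hq g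
    simp only [heard, if_neg hq, outgoing, hτ q, if_neg (hlt q), if_true, Option.elim_some]
  · intro p
    rw [h2 p, update, hτ p, if_neg (hlt p), if_pos rfl]
    simp only [advance, MovesUp, hτ]
    congr!

/-- The invariant after `i ≥ 1` stages; `U` is a set of items with one item per process. -/
structure Invariant (f K : ℕ) (F : Finset (Fin n)) (pro : Fin n → V) (U : Set (Fin n × V))
    (i : ℕ) (σ : Fin n → LocalState n V) : Prop where
  stage : ∀ p, (σ p).stage = i ∧ (σ p).echoing = false
  value_subset : ∀ p, p ∉ F → ∀ q, q ∉ F → (σ q).value ⊆ (σ p).valid (σ q).group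
  own_mem : ∀ p, p ∉ F → (p, pro p) ∈ (σ p).value
  chain : ∀ p, p ∉ F → ∀ q, q ∉ F → ∀ a < (σ q).group, (σ p).valid a ⊆ (σ q).value
  valid_subset : ∀ p, p ∉ F → ∀ q, q ∉ F → (σ p).valid (σ q).group ⊆ U
  group_eq_zero : i = 1 → ∀ p, p ∉ F → (σ p).group = 0
  -- Group `g` owns the sizes in an interval of length `2 ^ (K + 2 - i)`. The lower end is claimed
  -- only from `i = 2` on, since initial values are singletons.
  upper : ∀ q, q ∉ F → {x | ∃ p, p ∉ F ∧ x ∈ (σ p).valid (σ q).group}.ncard + 2 ^ K ≤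
    n - f - 1 + ((σ q).group + 1) * 2 ^ (K + 2 - i)
  lower : 2 ≤ i → ∀ q, q ∉ F →
    n - f - 1 + (σ q).group * 2 ^ (K + 2 - i) < (σ q).value.ncard + 2 ^ K

lemma finite_of_injOn_fst {U : Set (Fin n × V)} (hU : U.InjOn Prod.fst) : U.Finite :=
  Set.Finite.of_finite_image (Set.toFinite _) hU

lemma ncard_le_of_injOn_fst {U : Set (Fin n × V)} (hU : U.InjOn Prod.fst) : U.ncard ≤ n := by
  rw [← hU.ncard_image]
  simpa using Set.ncard_le_card (Prod.fst '' U)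

section Stage

variable {σ τ : Fin n → LocalState n V}
  {m m' : Fin n → Fin n → Option (ℕ → Set (Fin n × V))}

lemma IsStage.level_subset (h : IsStage f K F σ τ m m') (hF : F.card ≤ f) (p q : Fin n)
    (j g : ℕ) : level f j (m' p) g ⊆ level f (j + 1) (m' q) g :=
  level_subset_level_succ hF
    (fun r hr => by rw [h.heard_snd p r hr, h.heard_snd q r hr]) j

lemma IsStage.exists_valid (h : IsStage f K F σ τ m m') (hF : F.card ≤ f) (hn : 4 * f + 1 ≤ n)
    {p : Fin n} {g : ℕ} {x : Fin n × V} (hx : x ∈ level f 3 (m' p) g) :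
    ∃ q, q ∉ F ∧ x ∈ (σ q).valid g := by
  obtain ⟨q, hq, hxq⟩ := exists_heard_of_mem_level_three hF hn hx
  rw [h.heard_snd p q hq] at hxq
  exact ⟨q, hq, hxq.1⟩

lemma IsStage.valid_next (h : IsStage f K F σ τ m m') (hF : F.card ≤ f) (hn : 4 * f + 1 ≤ n)
    {p : Fin n} {g : ℕ} {x : Fin n × V} (hx : x ∈ (τ p).valid g) :
    ∃ q, q ∉ F ∧ x ∈ (σ q).valid (g / 2) := by
  rw [h.eq_advance p] at hx
  simp only [advance] at hx
  split_ifs at hx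
  · exact h.exists_valid hF hn hx
  · exact h.exists_valid hF hn
      (h.level_subset hF p p 2 _ (h.level_subset hF p p 1 _ hx))

end Stage

lemma Invariant.next {U : Set (Fin n × V)} {i : ℕ} {σ τ : Fin n → LocalState n V}
    {m m' : Fin n → Fin n → Option (ℕ → Set (Fin n × V))}
    (hF : F.card ≤ f) (hn : 4 * f + 1 ≤ n) (hU : U.InjOn Prod.fst)
    (hi : 1 ≤ i) (hiK : i < K + 2)
    (I : Invariant f K F pro U i σ) (h : IsStage f K F σ τ m m') :
    Invariant f K F pro U (i + 1) τ := by
  have hpow : 2 ^ (K + 2 - i) = 2 * 2 ^ (K + 1 - i) := by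
    rw [show K + 2 - i = (K + 1 - i) + 1 by omega, pow_succ, mul_comm]
  have hi1 : K + 2 - (i + 1) = K + 1 - i := by omega
  have value_level : ∀ p, ∀ q, q ∉ F → (σ q).value ⊆ level f 1 (m' p) (σ q).group := by
    intro p q hq x hx
    refine mem_level_one hF fun r hr => ?_
    rw [h.heard_snd p r hr]
    refine ⟨I.value_subset r hr q hq hx, ⟨q, ?_⟩, fun h0 => ?_⟩
    · rw [h.heard_fst r q hq]
      exact ⟨rfl, hx⟩
    · have := (I.stage r).1
      omega
  have level_sub_U : ∀ p, ∀ q, q ∉ F → level f 3 (m' p) (σ q).group ⊆ U := by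
    intro p q hq x hx
    obtain ⟨r, hr, hxr⟩ := h.exists_valid hF hn hx
    exact I.valid_subset r hr q hq hxr
  have hUfin := finite_of_injOn_fst hU
  have T_fin : ∀ p, p ∉ F → (level f 2 (m' p) (σ p).group).Finite := fun p hp =>
    hUfin.subset ((h.level_subset hF p p 2 _).trans (level_sub_U p p hp))
  have up : ∀ p, MovesUp f K (σ p) (m' p) →
      (τ p).group = 2 * (σ p).group + 1 ∧ (τ p).value = level f 2 (m' p) (σ p).group := by
    intro p hp
    rw [h.eq_advance p]
    simp [advance, hp]
  have down : ∀ p, ¬ MovesUp f K (σ p) (m' p) →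
      (τ p).group = 2 * (σ p).group ∧ (τ p).value = (σ p).value := by
    intro p hp
    rw [h.eq_advance p]
    simp [advance, hp]
  have valid_odd : ∀ p a, (τ p).valid (2 * a + 1) = level f 3 (m' p) a := by
    intro p a
    rw [h.eq_advance p]
    simp only [advance]
    rw [if_pos (by omega), show (2 * a + 1) / 2 = a by omega]
  have valid_even : ∀ p a, (τ p).valid (2 * a) = level f 1 (m' p) a := by
    intro p a
    rw [h.eq_advance p]
    simp only [advance]
    rw [if_neg (by omega), show (2 * a) / 2 = a by omega]
  have group_half : ∀ p, (τ p).group / 2 = (σ p).group := by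
    intro p
    by_cases hp : MovesUp f K (σ p) (m' p)
    · rw [(up p hp).1]; omega
    · rw [(down p hp).1]; omega
  have value_mono : ∀ p, p ∉ F → (σ p).value ⊆ (τ p).value := by
    intro p hp
    by_cases hu : MovesUp f K (σ p) (m' p)
    · rw [(up p hu).2]
      exact (value_level p p hp).trans (h.level_subset hF p p 1 _)
    · rw [(down p hu).2]
  -- For `i = 1` the threshold is `n - f - 1`, and level 2 contains every correct proposal.
  have all_up : i = 1 → ∀ p, p ∉ F → MovesUp f K (σ p) (m' p) := by
    rintro rfl p hp
    refine ⟨(I.stage p).1.ge, ?_⟩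
    have h0 := I.group_eq_zero rfl
    have hsub : (fun q => (q, pro q)) '' ((Fᶜ : Finset (Fin n)) : Set (Fin n)) ⊆
        level f 2 (m' p) (σ p).group := by
      rintro _ ⟨q, hq, rfl⟩
      have hq : q ∉ F := by simpa using hq
      refine h.level_subset hF p p 1 _ ?_
      rw [h0 p hp, ← h0 q hq]
      exact value_level p q hq (I.own_mem q hq)
    have hc := Set.ncard_le_ncard hsub (T_fin p hp)
    rw [Set.ncard_image_of_injective _ (fun a b hab => congrArg Prod.fst hab),
      Set.ncard_coe_finset, Finset.card_compl, Fintype.card_fin] at hc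
    rw [h0 p hp, (I.stage p).1] at *
    simp only [Nat.add_sub_cancel]
    omega
  refine ⟨?_, ?_, ?_, ?_, ?_, ?_, ?_, ?_⟩
  · intro p
    rw [h.eq_advance p]
    exact ⟨by simp [advance, (I.stage p).1], rfl⟩
  · intro p hp q hq
    by_cases hu : MovesUp f K (σ q) (m' q)
    · rw [(up q hu).1, (up q hu).2, valid_odd]
      exact h.level_subset hF q p 2 _
    · rw [(down q hu).1, (down q hu).2, valid_even]
      exact value_level p q hq
  · intro p hp
    exact value_mono p hp (I.own_mem p hp)
  · intro p hp q hq a ha x hx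
    have hle : a / 2 ≤ (σ q).group := by rw [← group_half q]; omega
    rcases hle.lt_or_eq with hlt | heq
    -- The groups were already separated: a newly valid item was valid before at some correct
    -- process.
    · obtain ⟨r, hr, hxr⟩ := h.valid_next hF hn hx
      exact value_mono q hq (I.chain r hr q hq _ hlt hxr)
    · by_cases hu : MovesUp f K (σ q) (m' q)
      · rw [(up q hu).1] at ha
        have hae : a = 2 * (σ q).group := by omega
        rw [(up q hu).2]
        rw [hae, valid_even] at hx
        exact h.level_subset hF p q 1 _ hx
      · rw [(down q hu).1] at ha
        omega
  · intro p hp q hq x hx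
    obtain ⟨r, hr, hxr⟩ := h.valid_next hF hn hx
    rw [group_half q] at hxr
    exact I.valid_subset r hr q hq hxr
  · intro h1
    omega
  · intro q hq
    rw [hi1]
    by_cases hu : MovesUp f K (σ q) (m' q)
    · rw [(up q hu).1]
      have hsub : {x | ∃ p, p ∉ F ∧ x ∈ (τ p).valid (2 * (σ q).group + 1)} ⊆
          {x | ∃ p, p ∉ F ∧ x ∈ (σ p).valid (σ q).group} := by
        rintro x ⟨p, -, hx⟩
        rw [valid_odd] at hx
        exact h.exists_valid hF hn hx
      have hc := Set.ncard_le_ncard hsub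
        (hUfin.subset (by rintro x ⟨p, hp, hx⟩; exact I.valid_subset p hp q hq hx))
      have hup := I.upper q hq
      rw [hpow] at hup
      linarith
    -- Whatever the lower half may hold is in level 1 somewhere, hence in the level 2 of `q`, which
    -- failed the threshold.
    · rw [(down q hu).1]
      have hsub : {x | ∃ p, p ∉ F ∧ x ∈ (τ p).valid (2 * (σ q).group)} ⊆
          level f 2 (m' q) (σ q).group := by
        rintro x ⟨p, -, hx⟩
        rw [valid_even] at hx
        exact h.level_subset hF p q 1 _ hx
      have hc := Set.ncard_le_ncard hsub (T_fin q hq)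
      have hnot : ¬ (n - f - 1 + (2 * (σ q).group + 1) * 2 ^ (K + 1 - i) <
          (level f 2 (m' q) (σ q).group).ncard + 2 ^ K) := by
        intro hlt
        refine hu ⟨by rw [(I.stage q).1]; exact hi, ?_⟩
        rw [(I.stage q).1]
        exact hlt
      linarith
  · intro _ q hq
    rw [hi1]
    by_cases hu : MovesUp f K (σ q) (m' q)
    · have := hu.2
      rw [(I.stage q).1] at this
      rwa [(up q hu).1, (up q hu).2]
    · have hne : i ≠ 1 := fun h1 => hu (all_up h1 q hq)
      have hlow := I.lower (by omega) q hq
      rw [hpow] at hlow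
      rw [(down q hu).1, (down q hu).2]
      linarith

/-- The first stage establishes the invariant. -/
lemma exists_invariant_one {τ : Fin n → LocalState n V}
    {m m' : Fin n → Fin n → Option (ℕ → Set (Fin n × V))}
    (hF : F.card ≤ f) (hn : 4 * f + 1 ≤ n) (hK : f + 1 ≤ 2 ^ K)
    (hpro : ∀ p, p ∉ F → pro p ∈ E)
    (h : IsStage f K F (fun p => start E p (pro p)) τ m m') :
    ∃ U : Set (Fin n × V), U.InjOn Prod.fst ∧ (∀ x ∈ U, x.2 ∈ E) ∧
      Invariant f K F pro U 1 τ := by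
  have hτ : ∀ p, (τ p).stage = 1 ∧ (τ p).echoing = false ∧ (τ p).group = 0 ∧
      (τ p).value = {(p, pro p)} ∧ (τ p).valid 0 = level f 1 (m' p) 0 := by
    intro p
    rw [h.eq_advance p]
    simp [advance, start, MovesUp]
  have hUinj : {x | ∃ p, p ∉ F ∧ x ∈ (τ p).valid 0}.InjOn Prod.fst := by
    rintro x ⟨p, hp, hx⟩ y ⟨q, hq, hy⟩ hxy
    rw [(hτ p).2.2.2.2] at hx
    rw [(hτ q).2.2.2.2] at hy
    obtain ⟨r, hr, hxr, hyr⟩ := exists_heard_heard_of_mem_level_one hF hn hx hy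
    rw [h.heard_snd _ r hr] at hxr hyr
    have h1 := hxr.2.2 rfl
    rw [show x.1 = y.1 from hxy, hyr.2.2 rfl] at h1
    exact (Set.singleton_injective h1).symm
  refine ⟨{x | ∃ p, p ∉ F ∧ x ∈ (τ p).valid 0}, hUinj, ?_, ?_⟩
  · rintro x ⟨p, hp, hx⟩
    obtain ⟨r, hr, hxr⟩ := h.valid_next hF hn hx
    exact hxr
  · refine ⟨fun p => ⟨(hτ p).1, (hτ p).2.1⟩, ?_, ?_, ?_, ?_, fun _ p _ => (hτ p).2.2.1, ?_, ?_⟩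
    · intro p hp q hq
      rw [(hτ q).2.2.1, (hτ q).2.2.2.1, (hτ p).2.2.2.2, Set.singleton_subset_iff]
      refine mem_level_one hF fun r hr => ?_
      have hh : heard (m r) q 0 = {(q, pro q)} := by
        rw [h.heard_fst r q hq]
        simp [start]
      rw [h.heard_snd p r hr]
      exact ⟨hpro q hq, ⟨q, by rw [hh]; rfl⟩, fun _ => hh⟩
    · intro p hp
      rw [(hτ p).2.2.2.1]
      rfl
    · intro p hp q hq a ha
      rw [(hτ q).2.2.1] at ha
      omega
    · intro p hp q hq x hx
      rw [(hτ q).2.2.1] at hx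
      exact ⟨p, hp, hx⟩
    · intro q hq
      rw [(hτ q).2.2.1]
      -- The interval of group `0` reaches up to `n - f - 1 + 2 ^ K ≥ n`.
      have := ncard_le_of_injOn_fst hUinj
      rw [show K + 2 - 1 = K + 1 by omega, pow_succ]
      omega
    · intro h2
      omega

lemma exists_invariant (hF : F.card ≤ f) (hn : 4 * f + 1 ≤ n) (hK : f + 1 ≤ 2 ^ K)
    (hpro : ∀ p, p ∉ F → pro p ∈ E) :
    ∃ U : Set (Fin n × V), U.InjOn Prod.fst ∧ (∀ x ∈ U, x.2 ∈ E) ∧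
      Invariant f K F pro U (K + 2) (states E f K F pro byz (2 * (K + 2))) := by
  obtain ⟨m, m', hS⟩ := exists_isStage (f := f) (K := K) (E := E) (F := F) (pro := pro)
    (byz := byz) (i := 0) (by omega) (fun p => ⟨rfl, rfl⟩)
  obtain ⟨U, hU, hUE, I⟩ := exists_invariant_one hF hn hK hpro hS
  refine ⟨U, hU, hUE, ?_⟩
  suffices ∀ i, i + 1 ≤ K + 2 →
      Invariant f K F pro U (i + 1) (states E f K F pro byz (2 * (i + 1))) from
    this (K + 1) le_rfl
  intro i
  induction i with
  | zero => exact fun _ => I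
  | succ i ih =>
    intro hi
    have J := ih (by omega)
    obtain ⟨m, m', hS⟩ := exists_isStage (by omega) J.stage
    exact J.next hF hn hU (by omega) (by omega) hS

lemma stage_lt {t : ℕ} (ht : t < 2 * (K + 2)) (p : Fin n) :
    (states E f K F pro byz t p).stage < K + 2 := by
  -- Twice the stage plus the echo flag counts completed rounds.
  have key : ∀ t p, 2 * (states E f K F pro byz t p).stage +
      (states E f K F pro byz t p).echoing.toNat ≤ t := by
    intro t
    induction t with
    | zero => intro p; simp [states, start]
    | succ t ih =>
      intro p
      have hp := ih p
      rw [states, update]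
      generalize states E f K F pro byz t p = s at hp ⊢
      split_ifs with h1 h2
      · omega
      · simp only [h2, Bool.toNat_true] at hp
        simp only [advance, Bool.toNat_false]
        omega
      · simp only [Bool.toNat_true]
        omega
  have := key t p
  omega

lemma states_of_le {t : ℕ} (ht : 2 * (K + 2) ≤ t) {p : Fin n}
    (hp : (states E f K F pro byz (2 * (K + 2)) p).stage = K + 2) :
    states E f K F pro byz t p = states E f K F pro byz (2 * (K + 2)) p := by
  induction t, ht using Nat.le_induction with
  | base => rfl
  | succ t _ ih => rw [states, ih, update, if_pos hp.ge]

/-- Distinct groups are ordered by `chain`. Within a group the size interval now has length one, so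
each value equals the union of the valid sets. -/
lemma Invariant.value_subset_or {U : Set (Fin n × V)} (hU : U.InjOn Prod.fst)
    {σ : Fin n → LocalState n V} (I : Invariant f K F pro U (K + 2) σ)
    {p q : Fin n} (hp : p ∉ F) (hq : q ∉ F) :
    (σ p).value ⊆ (σ q).value ∨ (σ q).value ⊆ (σ p).value := by
  rcases lt_trichotomy (σ p).group (σ q).group with hlt | heq | hlt
  · exact Or.inl ((I.value_subset p hp p hp).trans (I.chain p hp q hq _ hlt))
  · left
    have hW : {x | ∃ r, r ∉ F ∧ x ∈ (σ r).valid (σ q).group} ⊆ U := by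
      rintro x ⟨r, hr, hx⟩
      exact I.valid_subset r hr q hq hx
    have hsub : (σ q).value ⊆ {x | ∃ r, r ∉ F ∧ x ∈ (σ r).valid (σ q).group} :=
      fun x hx => ⟨q, hq, I.value_subset q hq q hq hx⟩
    have hup := I.upper q hq
    have hlow := I.lower (by omega) q hq
    have hEq := Set.eq_of_subset_of_ncard_le hsub
      (by simp only [Nat.sub_self, pow_zero, mul_one] at hup hlow; omega)
      ((finite_of_injOn_fst hU).subset hW)
    rw [hEq]
    intro x hx
    exact ⟨p, hp, heq ▸ I.value_subset p hp p hp hx⟩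
  · exact Or.inr ((I.value_subset q hq q hq).trans (I.chain q hq p hp _ hlt))

variable [SemilatticeSup V]

lemma exists_isLUB_of_finite {s : Set V} (hs : s.Finite) (hne : s.Nonempty) :
    ∃ d, IsLUB s d := by
  refine ⟨hs.toFinset.sup' (by simpa using hne) id, ?_⟩
  have h := hs.toFinset.isLUB_sup' (by simpa using hne)
  rwa [hs.coe_toFinset] at h

open Classical in
/-- Joins of the values of a chain of sets of items, one item per process, solve lattice
agreement. -/
lemma isLatticeAgreement_of_isLUB {U : Set (Fin n × V)} (hU : U.InjOn Prod.fst)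
    (hUE : ∀ x ∈ U, x.2 ∈ E) (hF : F.card ≤ f) {val : Fin n → Set (Fin n × V)}
    (hval : ∀ p, p ∉ F → val p ⊆ U) (hown : ∀ p, p ∉ F → (p, pro p) ∈ val p)
    (hchain : ∀ p, p ∉ F → ∀ q, q ∉ F → val p ⊆ val q ∨ val q ⊆ val p)
    {dec : Fin n → V} (hdec : ∀ p, p ∉ F → IsLUB (Prod.snd '' val p) (dec p)) :
    IsLatticeAgreement E f F pro dec := by
  have hUfin := finite_of_injOn_fst hU
  have hBfin : {x ∈ U | x.1 ∈ F}.Finite := hUfin.subset (Set.sep_subset _ _)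
  refine ⟨?_, ?_, hBfin.toFinset.image Prod.snd, ?_, ?_, ?_⟩
  · intro p hp q hq
    exact (hchain p hp q hq).imp
      (fun h => isLUB_le_iff (hdec p hp) |>.2 fun v hv =>
        (hdec q hq).1 (Set.image_mono h hv))
      (fun h => isLUB_le_iff (hdec q hq) |>.2 fun v hv =>
        (hdec p hp).1 (Set.image_mono h hv))
  · intro p hp
    exact (hdec p hp).1 ⟨_, hown p hp, rfl⟩
  · intro v hv
    simp only [Finset.coe_image, Set.Finite.coe_toFinset] at hv
    obtain ⟨x, hx, rfl⟩ := hv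
    exact hUE x hx.1
  · refine Finset.card_image_le.trans (le_trans ?_ hF)
    refine Finset.card_le_card_of_injOn Prod.fst ?_ ?_
    · intro x hx
      simp only [Set.Finite.coe_toFinset] at hx
      exact hx.2
    · intro x hx y hy hxy
      simp only [Set.Finite.coe_toFinset] at hx hy
      exact hU hx.1 hy.1 hxy
  · intro p hp
    have hpF : p ∈ Fᶜ := by simpa using hp
    refine ⟨⟨pro p, Finset.mem_union_left _ (Finset.mem_image_of_mem _ hpF)⟩, ?_⟩
    refine (isLUB_le_iff (hdec p hp)).2 ?_
    rintro _ ⟨x, hx, rfl⟩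
    refine Finset.le_sup' (f := id) ?_
    by_cases hxF : x.1 ∈ F
    · refine Finset.mem_union_right _ (Finset.mem_image_of_mem _ ?_)
      simpa using ⟨hval p hp hx, hxF⟩
    · refine Finset.mem_union_left _ ?_
      -- A correct originator has its true item in `U`, so no other item can bear its name.
      have hxe : x = (x.1, pro x.1) := hU (hval p hp hx) (hval _ hxF (hown _ hxF)) rfl
      rw [hxe]
      exact Finset.mem_image_of_mem _ (by simpa using hxF)

theorem algorithm_solves (hn : 4 * f + 1 ≤ n) (hK : f + 1 ≤ 2 ^ K) :
    (algorithm n E f K).SolvesByzantineLA E f (2 * (K + 2)) := by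
  intro F hF pro hpro byz
  change ℕ → Fin n → Fin n → Option (ℕ → Set (Fin n × V)) at byz
  simp only [run_algorithm]
  have : Nonempty V := ⟨pro ⟨0, by omega⟩⟩
  obtain ⟨U, hU, hUE, I⟩ := exists_invariant (byz := byz) hF hn hK hpro
  have hsub : ∀ p, p ∉ F →
      (states E f K F pro byz (2 * (K + 2)) p).value ⊆ U := fun p hp =>
    (I.value_subset p hp p hp).trans (I.valid_subset p hp p hp)
  have hlub : ∀ p, p ∉ F → ∃ d,
      IsLUB (Prod.snd '' (states E f K F pro byz (2 * (K + 2)) p).value) d :=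
    fun p hp => exists_isLUB_of_finite
      (((finite_of_injOn_fst hU).subset (hsub p hp)).image _) ⟨_, _, I.own_mem p hp, rfl⟩
  have hdecision : ∀ p, p ∉ F → ∃ d,
      IsLUB (Prod.snd '' (states E f K F pro byz (2 * (K + 2)) p).value) d ∧
      output K (states E f K F pro byz (2 * (K + 2)) p) =
        some d := by
    intro p hp
    have hc := And.intro (I.stage p).1.ge (hlub p hp)
    exact ⟨hc.2.choose, hc.2.choose_spec, dif_pos hc⟩
  choose! dec hdec hdec' using hdecision
  refine ⟨dec, fun p hp => ⟨_, le_rfl, hdec' p hp⟩, ?_, ?_,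
    isLatticeAgreement_of_isLUB hU hUE hF hsub I.own_mem
      (fun p hp q hq => I.value_subset_or hU hp hq) hdec⟩
  · intro p hp t v hv
    rcases lt_or_ge t (2 * (K + 2)) with ht | ht
    · have hlt := stage_lt (E := E) (f := f) (F := F) (pro := pro) (byz := byz) ht p
      change output K _ = _ at hv
      rw [output, dif_neg (fun hc => absurd hc.1 (not_le.2 hlt))] at hv
      cases hv
    · rw [states_of_le ht (I.stage p).1] at hv
      change output K _ = _ at hv
      rw [hdec' p hp] at hv
      exact (Option.some.inj hv).symm
  · intro p hp t ht q
    rw [states_of_le ht (I.stage p).1]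
    exact if_pos (I.stage p).1.ge

end Correctness

/-! ### Round count -/

/-- The number of rounds is logarithmic in the resilience. -/
lemma isBigO_rounds :
    Asymptotics.IsBigO Filter.atTop (fun f : ℕ => ((2 * (Nat.log 2 f + 1 + 2) : ℕ) : ℝ))
      (fun f : ℕ => Real.log (f : ℝ)) := by
  -- With `L = Nat.log 2 f ≥ 1`, `2 * (L + 3) ≤ 8 * L`.
  refine Asymptotics.IsBigO.of_bound (8 / Real.log 2) ?_
  filter_upwards [Filter.eventually_ge_atTop 2] with f hf
  have h2 : 0 < Real.log 2 := Real.log_pos (by norm_num)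
  have hlog : (Nat.log 2 f : ℝ) * Real.log 2 ≤ Real.log f := by
    rw [← Real.log_pow]
    refine Real.log_le_log (by positivity) ?_
    exact_mod_cast Nat.pow_log_le_self 2 (by omega)
  have hone : (1 : ℝ) ≤ Nat.log 2 f := by
    exact_mod_cast Nat.log_pos (by norm_num) hf
  have hnn : 0 ≤ Real.log f := by nlinarith
  rw [Real.norm_of_nonneg (by positivity), Real.norm_of_nonneg hnn, div_mul_eq_mul_div,
    le_div_iff₀ h2]
  push_cast
  nlinarith

end ByzantineLA

theorem mainTheorem5 :
    ∃ R : ℕ → ℕ,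
      Asymptotics.IsBigO Filter.atTop (fun f : ℕ => (R f : ℝ)) (fun f : ℕ => Real.log (f : ℝ)) ∧
      ∀ n f : ℕ, 4 * f + 1 ≤ n →
        ∀ (V : Type u) [SemilatticeSup V] (E : Set V),
          ∃ A : SyncAlgorithm n V, A.SolvesByzantineLA E f (R f) :=
  ⟨fun f => 2 * (Nat.log 2 f + 1 + 2), ByzantineLA.isBigO_rounds, fun n f hn V _ E =>
    ⟨ByzantineLA.algorithm n E f (Nat.log 2 f + 1),
      ByzantineLA.algorithm_solves hn (Nat.lt_pow_succ_log_self (by norm_num) f)⟩⟩
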